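/- Terminology. Let $S$ be a $(\vee,0)$-semilattice. For $e\in S$, $S$ satisfies $\mathrm{WURP}^{=}(e)$ if there is a positive integer $m$ such that for all families $(a_i)_{i\in I}$ and $(b_i)_{i\in I}$ of elements of $S$ with $e\le a_i\vee b_i$ for all $i\in I$, there are subsets $I_u\subseteq I$ ($u<m$) with $\bigcup_{u<m}I_u=I$ and elements $c_{i,j}\in S$ ($i,j\in I$) such that: (i) $c_{i,j}\le a_i\vee a_j$ and $c_{i,j}\le b_i\vee b_j$ for all $u<m$ and $i,j\in I_u$; (ii) $e\le a_j\vee b_i\vee c_{i,j}$ for all $u<m$ and $i,j\in I_u$; (iii) $c_{i,k}\le c_{i,j}\vee c_{j,k}$ for all $i,j,k\in I$. The semilattice $S$ satisfies $\mathrm{WURP}^{=}$ if it satisfies $\mathrm{WURP}^{=}(e)$ for all $e\in S$. An $S$-valued V-distance of type $3/2$ on a set $Y$ is a map $\delta\colon Y\times Y\to S$ such that $\delta(x,x)=0$, $\delta(x,y)=\delta(y,x)$ and $\delta(x,z)\le\delta(x,y)\vee\delta(y,z)$ for all $x,y,z\in Y$, and such that for all $x,y\in Y$ and $a,b\in S$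 with $\delta(x,y)\le a\vee b$ there is $z\in Y$ with either ($\delta(x,z)\le a$ and $\delta(z,y)\le b$) or ($\delta(x,z)\le b$ and $\delta(z,y)\le a$). Its range join-generates $S$ if every element of $S$ is the join of a finite set of elements of the range. For an algebra $A$ (a set with finitary operations of an arbitrary similarity type), $\operatorname{Con}A$ is its lattice of congruences and $\operatorname{Con_c}A$ is the $(\vee,0)$-semilattice of its compact (i.e., finitely generated) congruences. The algebra $A$ has almost permutable congruences if $a\vee b=ab\cup ba$ for all $a,b\in\operatorname{Con}A$, where $ab$ is the composition of relations. Statement. Let $M$ be either of the lattices $M_3$ or $N_5$, and let $F$ be the free bounded lattice on $\aleph_2$ generators in the variety of lattices generated by $M$; that is, $F$ is a bounded lattice belonging to this variety, together with a set $X\subseteq F$ of cardinality $\aleph_2$ such that every map from $X$ to a bounded lattice $K$ belonging to this variety extends to a unique lattice homomorphism $F\to K$ preserving $0$ and $1$. Let $L$ be any lattice that admits a surjective lattice homomorphism $L\to F$. Then: (1) $\operatorname{Con_c}L$ does not satisfy $\mathrm{WURP}^{=}$; (2) there are no set $Y$ and no $\operatorname{Con_c}L$-valued V-distance of type $3/2$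 on $Y$ whose range join-generates $\operatorname{Con_c}L$; (3) there is no algebra $A$ with almost permutable congruences such that $\operatorname{Con}L\cong\operatorname{Con}A$. -/

import Mathlib

universe u v w u₁ u₂ u₃ u₄ u₅ u₆ u₇

section Varieties

/-- Lattice terms in variables from `ν`. -/
inductive LatticeTerm (ν : Type u) : Type u
  | var : ν → LatticeTerm ν
  | sup : LatticeTerm ν → LatticeTerm ν → LatticeTerm ν
  | inf : LatticeTerm ν → LatticeTerm ν → LatticeTerm ν

/-- Value of a lattice term in a lattice under an assignment of its variables. -/
def LatticeTerm.eval {ν : Type u} {K : Type v} [Lattice K] (φ : ν → K) : LatticeTerm ν → K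
  | .var i => φ i
  | .sup s t => s.eval φ ⊔ t.eval φ
  | .inf s t => s.eval φ ⊓ t.eval φ

/-- The lattice `K` satisfies the identity `s = t`. -/
def SatisfiesIdentity (K : Type v) [Lattice K] (s t : LatticeTerm ℕ) : Prop :=
  ∀ φ : ℕ → K, s.eval φ = t.eval φ

/-- `K` belongs to the variety of lattices generated by `M`: it satisfies every lattice identity
that holds in `M`. -/
def InVarietyOf (M : Type u) [Lattice M] (K : Type v) [Lattice K] : Prop :=
  ∀ s t : LatticeTerm ℕ, SatisfiesIdentity M s t → SatisfiesIdentity K s t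

/-- Bounded lattice terms (with the two constants `0` and `1`) in generators from `X`. -/
inductive BoundedLatticeTerm (X : Type u) : Type u
  | of : X → BoundedLatticeTerm X
  | bot : BoundedLatticeTerm X
  | top : BoundedLatticeTerm X
  | sup : BoundedLatticeTerm X → BoundedLatticeTerm X → BoundedLatticeTerm X
  | inf : BoundedLatticeTerm X → BoundedLatticeTerm X → BoundedLatticeTerm X

/-- Value of a bounded lattice term in a bounded lattice. -/
def BoundedLatticeTerm.eval {X : Type u} {K : Type v} [Lattice K] [BoundedOrder K] (φ : X → K) :
    BoundedLatticeTerm X → K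
  | .of x => φ x
  | .bot => ⊥
  | .top => ⊤
  | .sup s t => s.eval φ ⊔ t.eval φ
  | .inf s t => s.eval φ ⊓ t.eval φ

/-- Substitution of bounded lattice terms for the variables of a lattice term. -/
def LatticeTerm.subst {X : Type u} (σ : ℕ → BoundedLatticeTerm X) :
    LatticeTerm ℕ → BoundedLatticeTerm X
  | .var i => σ i
  | .sup s t => .sup (s.subst σ) (t.subst σ)
  | .inf s t => .inf (s.subst σ) (t.subst σ)

/-- Equality of bounded lattice terms derivable from the lattice identities of `M` (which include
the lattice axioms) and the two laws `0 ∨ t = t` and `t ∨ 1 = 1`. -/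
inductive FreeRel (M : Type v) [Lattice M] (X : Type u) :
    BoundedLatticeTerm X → BoundedLatticeTerm X → Prop
  | refl (t : BoundedLatticeTerm X) : FreeRel M X t t
  | symm {s t : BoundedLatticeTerm X} : FreeRel M X s t → FreeRel M X t s
  | trans {r s t : BoundedLatticeTerm X} : FreeRel M X r s → FreeRel M X s t → FreeRel M X r t
  | sup_congr {s s' t t' : BoundedLatticeTerm X} :
      FreeRel M X s s' → FreeRel M X t t' → FreeRel M X (.sup s t) (.sup s' t')
  | inf_congr {s s' t t' : BoundedLatticeTerm X} :
      FreeRel M X s s' → FreeRel M X t t' → FreeRel M X (.inf s t) (.inf s' t')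
  | identity (s t : LatticeTerm ℕ) (h : SatisfiesIdentity M s t) (σ : ℕ → BoundedLatticeTerm X) :
      FreeRel M X (s.subst σ) (t.subst σ)
  | bot_sup (t : BoundedLatticeTerm X) : FreeRel M X (.sup .bot t) t
  | sup_top (t : BoundedLatticeTerm X) : FreeRel M X (.sup t .top) .top

/-- Derivable equality as an equivalence relation. -/
def freeSetoid (M : Type v) [Lattice M] (X : Type u) : Setoid (BoundedLatticeTerm X) where
  r := FreeRel M X
  iseqv := ⟨.refl, .symm, .trans⟩

/-- The free bounded lattice on the set `X` of generators in the variety of lattices generated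
by `M`. -/
def FreeBoundedLattice (M : Type v) [Lattice M] (X : Type u) : Type u :=
  Quotient (freeSetoid M X)

namespace FreeBoundedLattice

variable {M : Type v} [Lattice M] {X : Type u}

/-- The class of a bounded lattice term. -/
def mk (t : BoundedLatticeTerm X) : FreeBoundedLattice M X := Quotient.mk (freeSetoid M X) t

/-- The free generators. -/
def of (x : X) : FreeBoundedLattice M X := mk (.of x)

theorem sound {s t : BoundedLatticeTerm X} (h : FreeRel M X s t) :
    (mk s : FreeBoundedLattice M X) = mk t := Quotient.sound h

theorem exact {s t : BoundedLatticeTerm X} (h : (mk s : FreeBoundedLattice M X) = mk t) :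
    FreeRel M X s t := Quotient.exact h

theorem ind {P : FreeBoundedLattice M X → Prop} (h : ∀ t, P (mk t)) (a) : P a :=
  Quotient.ind h a

/-- The join. -/
def join : FreeBoundedLattice M X → FreeBoundedLattice M X → FreeBoundedLattice M X :=
  Quotient.map₂ .sup fun _ _ h _ _ h' => FreeRel.sup_congr h h'

/-- The meet. -/
def meet : FreeBoundedLattice M X → FreeBoundedLattice M X → FreeBoundedLattice M X :=
  Quotient.map₂ .inf fun _ _ h _ _ h' => FreeRel.inf_congr h h'

/-- An assignment of three terms to the variables `0`, `1`, `2`. -/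
def asg (r s t : BoundedLatticeTerm X) : ℕ → BoundedLatticeTerm X
  | 0 => r
  | 1 => s
  | _ => t

instance instLattice : Lattice (FreeBoundedLattice M X) :=
  @Lattice.mk' _ ⟨join⟩ ⟨meet⟩
    (ind fun s => ind fun t => sound <| FreeRel.identity
      (.sup (.var 0) (.var 1)) (.sup (.var 1) (.var 0))
      (fun _ => sup_comm _ _) (asg s t t))
    (ind fun r => ind fun s => ind fun t => sound <| FreeRel.identity
      (.sup (.sup (.var 0) (.var 1)) (.var 2)) (.sup (.var 0) (.sup (.var 1) (.var 2)))
      (fun _ => sup_assoc _ _ _) (asg r s t))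
    (ind fun s => ind fun t => sound <| FreeRel.identity
      (.inf (.var 0) (.var 1)) (.inf (.var 1) (.var 0))
      (fun _ => inf_comm _ _) (asg s t t))
    (ind fun r => ind fun s => ind fun t => sound <| FreeRel.identity
      (.inf (.inf (.var 0) (.var 1)) (.var 2)) (.inf (.var 0) (.inf (.var 1) (.var 2)))
      (fun _ => inf_assoc _ _ _) (asg r s t))
    (ind fun s => ind fun t => sound <| FreeRel.identity
      (.sup (.var 0) (.inf (.var 0) (.var 1))) (.var 0)
      (fun _ => sup_inf_self) (asg s t t))
    (ind fun s => ind fun t => sound <| FreeRel.identity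
      (.inf (.var 0) (.sup (.var 0) (.var 1))) (.var 0)
      (fun _ => inf_sup_self) (asg s t t))

theorem mk_sup (s t : BoundedLatticeTerm X) :
    (mk (.sup s t) : FreeBoundedLattice M X) = mk s ⊔ mk t := rfl

theorem mk_inf (s t : BoundedLatticeTerm X) :
    (mk (.inf s t) : FreeBoundedLattice M X) = mk s ⊓ mk t := rfl

instance instBoundedOrder : BoundedOrder (FreeBoundedLattice M X) where
  bot := mk .bot
  bot_le := ind fun t => sup_eq_right.mp (sound (.bot_sup t))
  top := mk .top
  le_top := ind fun t => sup_eq_right.mp (sound (.sup_top t))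

theorem eval_mk (σ : ℕ → BoundedLatticeTerm X) (s : LatticeTerm ℕ) :
    s.eval (fun i => (mk (σ i) : FreeBoundedLattice M X)) = mk (s.subst σ) := by
  induction s with
  | var i => rfl
  | sup s t hs ht => simp only [LatticeTerm.eval, LatticeTerm.subst, hs, ht, mk_sup]
  | inf s t hs ht => simp only [LatticeTerm.eval, LatticeTerm.subst, hs, ht, mk_inf]

/-- The free bounded lattice belongs to the variety. -/
theorem inVarietyOf : InVarietyOf M (FreeBoundedLattice M X) := by
  intro s t h φ
  have hφ : φ = fun i => mk (φ i).out := funext fun i => (Quotient.out_eq (φ i)).symm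
  rw [hφ, eval_mk, eval_mk]
  exact sound (.identity s t h _)

theorem eval_subst {K : Type w} [Lattice K] [BoundedOrder K] (φ : X → K)
    (σ : ℕ → BoundedLatticeTerm X) (s : LatticeTerm ℕ) :
    (s.subst σ).eval φ = s.eval fun i => (σ i).eval φ := by
  induction s with
  | var i => rfl
  | sup s t hs ht => simp only [LatticeTerm.eval, LatticeTerm.subst, BoundedLatticeTerm.eval, hs, ht]
  | inf s t hs ht => simp only [LatticeTerm.eval, LatticeTerm.subst, BoundedLatticeTerm.eval, hs, ht]

theorem eval_eq_of_freeRel {K : Type w} [Lattice K] [BoundedOrder K] (hK : InVarietyOf M K)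
    (φ : X → K) {s t : BoundedLatticeTerm X} (h : FreeRel M X s t) : s.eval φ = t.eval φ := by
  induction h with
  | refl => rfl
  | symm _ ih => exact ih.symm
  | trans _ _ ih ih' => exact ih.trans ih'
  | sup_congr _ _ ih ih' => simp only [BoundedLatticeTerm.eval, ih, ih']
  | inf_congr _ _ ih ih' => simp only [BoundedLatticeTerm.eval, ih, ih']
  | identity s t h σ => rw [eval_subst, eval_subst]; exact hK s t h _
  | bot_sup t => simp [BoundedLatticeTerm.eval]
  | sup_top t => simp [BoundedLatticeTerm.eval]

/-- The universal property: every map from `X` to a bounded lattice in the variety extends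
uniquely to a homomorphism of bounded lattices. -/
theorem existsUnique_lift {K : Type w} [Lattice K] [BoundedOrder K] (hK : InVarietyOf M K)
    (φ : X → K) : ∃! f : BoundedLatticeHom (FreeBoundedLattice M X) K, ∀ x, f (of x) = φ x := by
  refine ⟨{ toFun := Quotient.lift (fun t => t.eval φ) fun _ _ h => eval_eq_of_freeRel hK φ h
            map_sup' := ind fun _ => ind fun _ => rfl
            map_inf' := ind fun _ => ind fun _ => rfl
            map_top' := rfl
            map_bot' := rfl }, fun _ => rfl, ?_⟩
  intro g hg
  refine DFunLike.ext _ _ (ind fun t => ?_)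
  change g (mk t) = t.eval φ
  induction t with
  | of x => exact hg x
  | bot => exact map_bot g
  | top => exact map_top g
  | sup s t hs ht => rw [mk_sup, map_sup, hs, ht]; rfl
  | inf s t hs ht => rw [mk_inf, map_inf, hs, ht]; rfl

end FreeBoundedLattice

/-- The lattice `M₃`: bounds `zero`, `one` and three pairwise incomparable atoms. -/
inductive M3Lattice : Type
  | zero | p | q | r | one
  deriving DecidableEq

namespace M3Lattice

/-- The join of `M3`. -/
def join : M3Lattice → M3Lattice → M3Lattice
  | x, y => if x = y then x else if x = zero then y else if y = zero then x else one

/-- The meet of `M3`. -/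
def meet : M3Lattice → M3Lattice → M3Lattice
  | x, y => if x = y then x else if x = one then y else if y = one then x else zero

instance instFintype : Fintype M3Lattice :=
  ⟨{zero, p, q, r, one}, fun x => by cases x <;> decide⟩

instance instLattice : Lattice M3Lattice :=
  @Lattice.mk' _ ⟨join⟩ ⟨meet⟩ (by decide) (by decide) (by decide) (by decide) (by decide) (by decide)

end M3Lattice

/-- The pentagon `N₅`: `zero < a < c < one`, and `b` is a complement of both `a` and `c`. -/
inductive N5Lattice : Type
  | zero | a | b | c | one
  deriving DecidableEq

namespace N5Lattice

/-- The join of `N5`. -/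
def join : N5Lattice → N5Lattice → N5Lattice
    | zero, y => y
    | x, zero => x
    | one, _ => one
    | _, one => one
    | b, b => b
    | b, _ => one
    | _, b => one
    | a, y => y
    | c, _ => c

/-- The meet of `N5`. -/
def meet : N5Lattice → N5Lattice → N5Lattice
    | one, y => y
    | x, one => x
    | zero, _ => zero
    | _, zero => zero
    | b, b => b
    | b, _ => zero
    | _, b => zero
    | c, y => y
    | a, _ => a

instance instFintype : Fintype N5Lattice :=
  ⟨{zero, a, b, c, one}, fun x => by cases x <;> decide⟩

instance instLattice : Lattice N5Lattice :=
  @Lattice.mk' _ ⟨join⟩ ⟨meet⟩ (by decide) (by decide) (by decide) (by decide) (by decide) (by decide)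

end N5Lattice

end Varieties

section Semilattices

/-- The property `WURP⁼` at an element `e` of a join-semilattice with zero; the index sets of the
families range over the types of the universe `w`. -/
def WURPEqAt {S : Type u} [SemilatticeSup S] [OrderBot S] (e : S) : Prop :=
  ∃ m : ℕ, 0 < m ∧
    ∀ (I : Type w) (a b : I → S), (∀ i, e ≤ a i ⊔ b i) →
      ∃ (J : Fin m → Set I) (c : I → I → S),
        (⋃ k, J k) = Set.univ ∧
        (∀ k, ∀ i ∈ J k, ∀ j ∈ J k, c i j ≤ a i ⊔ a j ∧ c i j ≤ b i ⊔ b j) ∧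
        (∀ k, ∀ i ∈ J k, ∀ j ∈ J k, e ≤ a j ⊔ b i ⊔ c i j) ∧
        (∀ i j l, c i l ≤ c i j ⊔ c j l)

/-- The property `WURP⁼` of a join-semilattice with zero. -/
def WURPEq (S : Type u) [SemilatticeSup S] [OrderBot S] : Prop :=
  ∀ e : S, WURPEqAt.{u, w} e

/-- `δ` is an `S`-valued distance on `X`. -/
structure IsSemilatticeDistance {X : Type v} {S : Type u} [SemilatticeSup S] [OrderBot S]
    (δ : X → X → S) : Prop where
  self (x : X) : δ x x = ⊥
  comm (x y : X) : δ x y = δ y x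
  triangle (x y z : X) : δ x z ≤ δ x y ⊔ δ y z

/-- `δ` is a V-distance of type `3/2`. -/
structure IsVDistanceThreeHalves {X : Type v} {S : Type u} [SemilatticeSup S] [OrderBot S]
    (δ : X → X → S) : Prop extends IsSemilatticeDistance δ where
  vCondition (x y : X) (a b : S) : δ x y ≤ a ⊔ b →
    ∃ z, (δ x z ≤ a ∧ δ z y ≤ b) ∨ (δ x z ≤ b ∧ δ z y ≤ a)

/-- Every element of `S` is the join of a finite set of elements of `R`. -/
def JoinGenerates {S : Type u} [SemilatticeSup S] [OrderBot S] (R : Set S) : Prop :=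
  ∀ s : S, ∃ t : Finset S, ↑t ⊆ R ∧ t.sup id = s

/-- The compact elements of a complete lattice. -/
abbrev CompactElements (α : Type u) [CompleteLattice α] : Type u := {a : α // IsCompactElement a}

theorem isCompactElement_sup' {α : Type u} [CompleteLattice α] {a b : α}
    (ha : IsCompactElement a) (hb : IsCompactElement b) : IsCompactElement (a ⊔ b) := by
  rw [CompleteLattice.isCompactElement_iff_le_of_directed_sSup_le] at *
  intro s hs hd h
  obtain ⟨x, hx, hax⟩ := ha s hs hd (le_sup_left.trans h)
  obtain ⟨y, hy, hby⟩ := hb s hs hd (le_sup_right.trans h)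
  obtain ⟨z, hz, hxz, hyz⟩ := hd x hx y hy
  exact ⟨z, hz, sup_le (hax.trans hxz) (hby.trans hyz)⟩

theorem isCompactElement_bot' {α : Type u} [CompleteLattice α] : IsCompactElement (⊥ : α) :=
  fun _ _ hs _ _ _ => hs.imp fun _ hx => ⟨hx, bot_le⟩

instance CompactElements.instSemilatticeSup (α : Type u) [CompleteLattice α] :
    SemilatticeSup (CompactElements α) :=
  Subtype.semilatticeSup fun _ _ ha hb => isCompactElement_sup' ha hb

instance CompactElements.instOrderBot (α : Type u) [CompleteLattice α] :
    OrderBot (CompactElements α) :=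
  Subtype.orderBot isCompactElement_bot'

end Semilattices

section Congruences

theorem LatticeCon.toSetoid_injective {L : Type u} [Lattice L] :
    Function.Injective (LatticeCon.toSetoid : LatticeCon L → Setoid L) := by
  rintro ⟨_, _, _⟩ ⟨_, _, _⟩ h
  cases h
  rfl

instance LatticeCon.instPartialOrder (L : Type u) [Lattice L] : PartialOrder (LatticeCon L) :=
  PartialOrder.lift LatticeCon.toSetoid LatticeCon.toSetoid_injective

instance LatticeCon.instInfSet (L : Type u) [Lattice L] : InfSet (LatticeCon L) where
  sInf C :=
    { toSetoid := sInf (LatticeCon.toSetoid '' C)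
      inf := by
        rintro w x y z h h' _ ⟨c, hc, rfl⟩
        exact c.inf (h _ ⟨c, hc, rfl⟩) (h' _ ⟨c, hc, rfl⟩)
      sup := by
        rintro w x y z h h' _ ⟨c, hc, rfl⟩
        exact c.sup (h _ ⟨c, hc, rfl⟩) (h' _ ⟨c, hc, rfl⟩) }

/-- The congruence lattice `Con L` of a lattice `L`, ordered by inclusion. -/
instance LatticeCon.instCompleteLattice (L : Type u) [Lattice L] : CompleteLattice (LatticeCon L) :=
  completeLatticeOfInf _ fun C =>
    ⟨fun c hc _ _ h => h _ ⟨c, hc, rfl⟩,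
     fun d hd x y h => by
      rintro _ ⟨c, hc, rfl⟩
      exact hd hc h⟩

/-- `Con_c L`, the join-semilattice with zero of all compact congruences of a lattice `L`. -/
abbrev ConC (L : Type u) [Lattice L] : Type u := CompactElements (LatticeCon L)

/-- A congruence of a (universal, finitary) algebra: an equivalence relation that is compatible
with all operations. -/
structure AlgebraCon (σ : FirstOrder.Language.{u, v}) (A : Type w) [σ.Structure A] extends Setoid A where
  funMap {n : ℕ} (f : σ.Functions n) {x y : Fin n → A} :
    (∀ i, r (x i) (y i)) → r (FirstOrder.Language.Structure.funMap f x) (FirstOrder.Language.Structure.funMap f y)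

variable {σ : FirstOrder.Language.{u, v}} {A : Type w} [σ.Structure A]

theorem AlgebraCon.toSetoid_injective :
    Function.Injective (AlgebraCon.toSetoid : AlgebraCon σ A → Setoid A) := by
  rintro ⟨_, _⟩ ⟨_, _⟩ h
  cases h
  rfl

instance AlgebraCon.instPartialOrder : PartialOrder (AlgebraCon σ A) :=
  PartialOrder.lift AlgebraCon.toSetoid AlgebraCon.toSetoid_injective

instance AlgebraCon.instInfSet : InfSet (AlgebraCon σ A) where
  sInf C :=
    { toSetoid := sInf (AlgebraCon.toSetoid '' C)
      funMap := by
        rintro n f x y h _ ⟨c, hc, rfl⟩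
        exact c.funMap f fun i => h i _ ⟨c, hc, rfl⟩ }

/-- The congruence lattice `Con A` of an algebra `A`, ordered by inclusion. -/
instance AlgebraCon.instCompleteLattice : CompleteLattice (AlgebraCon σ A) :=
  completeLatticeOfInf _ fun C =>
    ⟨fun c hc _ _ h => h _ ⟨c, hc, rfl⟩,
     fun d hd x y h => by
      rintro _ ⟨c, hc, rfl⟩
      exact hd hc h⟩

variable (σ A) in
/-- `A` has almost permutable congruences: `a ∨ b = ab ∪ ba` for all congruences `a`, `b`. -/
def AlmostPermutableCongruences : Prop :=
  ∀ (a b : AlgebraCon σ A) (x y : A),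
    (a ⊔ b).r x y ↔ (∃ z, a.r x z ∧ b.r z y) ∨ (∃ z, b.r x z ∧ a.r z y)

end Congruences

/-! Everything rests on the failure of `WURPEq`. A V-distance of type 3/2 with join-generating range
forces `WURPEq`, and almost permutability turns the principal congruences of an algebra into such a
distance; hence `IsBadTriple.not_wurpEq` gives all three claims.

For that failure, split the free generators into pairs (x_i, y_i) indexed by a set of size ℵ₂. In
`L`, up to lifting along the surjection, let e identify 0 with 1, let a_i identify x_i with 0 and
y_i with 1, and let b_i identify x_i with y_i. Then e ≤ a_i ∨ b_i by transitivity. Suppose `WURPEq`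
yields congruences c_ij. One of the finitely many blocks has size ℵ₂, and whether c_ij lies in the
kernel of an evaluation depends on finitely many generators. Kuratowski's theorem therefore gives i,
j, k in that block such that the generators of each one are irrelevant to the c of the other two.

Evaluate the pairs of i, j, k at (⊥, p), (q, ⊤), (⊥, r). As far as c_ij is concerned, the values lie
in the Boolean lattice {⊥, p, q, ⊤}, which embeds into a product of two two-element lattices. In one
coordinate a_i and a_j are collapsed, in the other b_i and b_j, so c_ij is collapsed. The same works
for c_jk with {⊥, q, r, ⊤}, and the triangle inequality collapses c_ik. But in {⊥, p, r, ⊤} the cut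
"above r" collapses a_k, b_i and c_ik, hence also e: this says 0 = 1 in a two-element lattice. -/

section VDistances

/-! ### From V-distances to `WURPEq` -/

/-- A semilattice that is join-generated by the range of a V-distance of type `3/2` satisfies
`WURP⁼`. -/
theorem IsVDistanceThreeHalves.wurpEq {Y : Type v} {S : Type u} [SemilatticeSup S] [OrderBot S]
    {δ : Y → Y → S} (hδ : IsVDistanceThreeHalves δ)
    (hgen : JoinGenerates (Set.range fun p : Y × Y => δ p.1 p.2)) : WURPEq.{u, w} S := by
  classical
  intro e
  obtain ⟨t, ht, rfl⟩ := hgen e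
  have hxy : ∀ s : t, ∃ p : Y × Y, δ p.1 p.2 = s := fun s => ht s.2
  choose p hp using hxy
  -- The blocks are the patterns recording, for each of the finitely many distances that make up e,
  -- whether the midpoint z has its a-part first; m counts these patterns, independently of the
  -- families.
  let κ := Fintype.equivFin (t → Prop)
  refine ⟨Fintype.card (t → Prop), Fintype.card_pos, fun I a b hab => ?_⟩
  have hz : ∀ (i : I) (s : t), ∃ z, (δ (p s).1 z ≤ a i ∧ δ z (p s).2 ≤ b i) ∨
      (δ (p s).1 z ≤ b i ∧ δ z (p s).2 ≤ a i) := fun i s =>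
    hδ.vCondition _ _ _ _ ((hp s).le.trans ((Finset.le_sup (f := id) s.2).trans (hab i)))
  choose z hz using hz
  let T : I → t → Prop := fun i s => δ (p s).1 (z i s) ≤ a i ∧ δ (z i s) (p s).2 ≤ b i
  have hT : ∀ i s, ¬ T i s → δ (p s).1 (z i s) ≤ b i ∧ δ (z i s) (p s).2 ≤ a i :=
    fun i s h => (hz i s).resolve_left h
  have key : ∀ k, ∀ i ∈ {i | κ (T i) = k}, ∀ j ∈ {i | κ (T i) = k}, T i = T j :=
    fun k i hi j hj => κ.injective (hi.trans hj.symm)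
  have left : ∀ i j s, δ (z i s) (z j s) ≤ δ (p s).1 (z i s) ⊔ δ (p s).1 (z j s) := fun i j s => by
    rw [hδ.comm (p s).1 (z i s)]
    exact hδ.triangle _ _ _
  have right : ∀ i j s, δ (z i s) (z j s) ≤ δ (z i s) (p s).2 ⊔ δ (z j s) (p s).2 :=
    fun i j s => by
      rw [hδ.comm (z j s) (p s).2]
      exact hδ.triangle _ _ _
  refine ⟨fun k => {i | κ (T i) = k}, fun i j => Finset.univ.sup fun s : t => δ (z i s) (z j s),
    ?_, ?_, ?_, ?_⟩
  · ext i
    simp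
  · intro k i hi j hj
    have hij := key k i hi j hj
    -- Equal patterns place z_i and z_j within a_i and a_j of a common endpoint, and within b_i and
    -- b_j of the other one.
    refine ⟨Finset.sup_le fun s _ => ?_, Finset.sup_le fun s _ => ?_⟩ <;> by_cases h : T i s
    · exact (left i j s).trans (sup_le_sup h.1 (hij ▸ h : T j s).1)
    · exact (right i j s).trans (sup_le_sup (hT i s h).2 (hT j s (hij ▸ h)).2)
    · exact (right i j s).trans (sup_le_sup h.2 (hij ▸ h : T j s).2)
    · exact (left i j s).trans (sup_le_sup (hT i s h).1 (hT j s (hij ▸ h)).1)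
  · intro k i hi j hj
    have hij := key k i hi j hj
    refine Finset.sup_le fun s hs => ?_
    have hc : δ (z i ⟨s, hs⟩) (z j ⟨s, hs⟩) ≤ Finset.univ.sup fun s : t => δ (z i s) (z j s) :=
      Finset.le_sup (f := fun s : t => δ (z i s) (z j s)) (Finset.mem_univ (⟨s, hs⟩ : t))
    change s ≤ _
    rw [show s = δ (p ⟨s, hs⟩).1 (p ⟨s, hs⟩).2 from (hp ⟨s, hs⟩).symm]
    have tri : ∀ u v, δ (p ⟨s, hs⟩).1 (p ⟨s, hs⟩).2 ≤
        δ (p ⟨s, hs⟩).1 u ⊔ δ u v ⊔ δ v (p ⟨s, hs⟩).2 := fun u v =>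
      (hδ.triangle _ v _).trans (sup_le_sup_right (hδ.triangle _ u _) _)
    -- The pattern decides which midpoint is visited first; either order costs only a_j, c_ij and
    -- b_i.
    by_cases h : T i ⟨s, hs⟩
    · refine (tri (z j ⟨s, hs⟩) (z i ⟨s, hs⟩)).trans (sup_le (sup_le ?_ ?_) ?_)
      · exact (hij ▸ h : T j ⟨s, hs⟩).1.trans (le_sup_left.trans le_sup_left)
      · rw [hδ.comm]
        exact hc.trans le_sup_right
      · exact h.2.trans (le_sup_right.trans le_sup_left)
    · refine (tri (z i ⟨s, hs⟩) (z j ⟨s, hs⟩)).trans (sup_le (sup_le ?_ ?_) ?_)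
      · exact (hT i _ h).1.trans (le_sup_right.trans le_sup_left)
      · exact hc.trans le_sup_right
      · exact (hT j _ (hij ▸ h)).2.trans (le_sup_left.trans le_sup_left)
  · intro i j l
    rw [← Finset.sup_sup]
    exact Finset.sup_mono_fun fun s _ => hδ.triangle _ _ _

end VDistances

/-! ### Principal and compact congruences -/

section PrincipalCongruences

theorem OrderIso.isCompactElement {α : Type u} {β : Type v} [PartialOrder α] [PartialOrder β]
    (f : α ≃o β) {a : α} (ha : IsCompactElement a) : IsCompactElement (f a) := by
  intro s u hs hd hu hau
  obtain ⟨x, ⟨y, hy, rfl⟩, hx⟩ := ha (f.symm '' s) (f.symm u) (hs.image _)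
    (hd.mono_comp (rb := (· ≤ ·)) (g := f.symm) fun _ _ h => f.symm.monotone h)
    (f.symm.isLUB_image'.2 hu) (f.le_symm_apply.2 hau)
  exact ⟨y, hy, f.le_symm_apply.1 hx⟩

namespace LatticeCon

variable {L : Type u} [Lattice L]

theorem r_of_le {c d : LatticeCon L} (h : c ≤ d) {x y : L} (hxy : c.r x y) : d.r x y := h hxy

/-- The principal congruence generated by a pair of elements. -/
def principal (x y : L) : LatticeCon L := sInf {c | c.r x y}

theorem principal_le {x y : L} {c : LatticeCon L} : principal x y ≤ c ↔ c.r x y := by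
  refine ⟨fun h => h ?_, fun h => sInf_le h⟩
  rintro _ ⟨d, hd, rfl⟩
  exact hd

theorem r_principal (x y : L) : (principal x y).r x y := principal_le.1 le_rfl

/-- The union of a nonempty directed family of congruences is already a congruence, so it contains
the supremum. This is what makes principal congruences compact. -/
theorem exists_mem_r_of_sSup_r {s : Set (LatticeCon L)} (hs : s.Nonempty)
    (hd : DirectedOn (· ≤ ·) s) {x y : L} (h : (sSup s).r x y) : ∃ c ∈ s, c.r x y := by
  have join : ∀ {w x y z : L}, (∃ c ∈ s, c.r w x) → (∃ c ∈ s, c.r y z) →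
      ∃ c ∈ s, c.r w x ∧ c.r y z := by
    rintro w x y z ⟨c, hc, h⟩ ⟨d, hd', h'⟩
    obtain ⟨m, hm, hcm, hdm⟩ := hd c hc d hd'
    exact ⟨m, hm, hcm h, hdm h'⟩
  let U : LatticeCon L :=
    { r := fun x y => ∃ c ∈ s, c.r x y
      iseqv :=
        { refl := fun x => hs.imp fun c hc => ⟨hc, c.refl x⟩
          symm := fun ⟨c, hc, h⟩ => ⟨c, hc, c.symm h⟩
          trans := fun h h' =>
            let ⟨c, hc, h, h'⟩ := join h h'
            ⟨c, hc, c.trans h h'⟩ }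
      inf := fun h h' =>
        let ⟨c, hc, h, h'⟩ := join h h'
        ⟨c, hc, c.inf h h'⟩
      sup := fun h h' =>
        let ⟨c, hc, h, h'⟩ := join h h'
        ⟨c, hc, c.sup h h'⟩ }
  exact r_of_le (sSup_le fun c hc _ _ h => ⟨c, hc, h⟩ : sSup s ≤ U) h

theorem isCompactElement_principal (x y : L) : IsCompactElement (principal x y) := by
  rw [CompleteLattice.isCompactElement_iff_le_of_directed_sSup_le]
  intro s hs hd h
  obtain ⟨c, hc, h⟩ := exists_mem_r_of_sSup_r hs hd (principal_le.1 h)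
  exact ⟨c, hc, principal_le.2 h⟩

/-- A compact congruence is generated by finitely many pairs. -/
theorem exists_finset_le_iff {c : LatticeCon L} (hc : IsCompactElement c) :
    ∃ G : Finset (L × L), ∀ d : LatticeCon L, c ≤ d ↔ ∀ p ∈ G, d.r p.1 p.2 := by
  obtain ⟨G, hG⟩ := CompleteLattice.IsCompactElement.exists_finset_of_le_iSup _ hc (fun p : {p : L × L // c.r p.1 p.2} =>
      principal p.1.1 p.1.2) fun x y h =>
    r_of_le (le_iSup (fun p : {p : L × L // c.r p.1 p.2} => principal p.1.1 p.1.2) ⟨(x, y), h⟩)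
      (r_principal x y)
  refine ⟨G.map (Function.Embedding.subtype _), fun d => ⟨fun h p hp => ?_, fun h => ?_⟩⟩
  · obtain ⟨q, -, rfl⟩ := Finset.mem_map.1 hp
    exact h q.2
  · exact hG.trans (iSup₂_le fun p hp => principal_le.2 (h _ (Finset.mem_map_of_mem _ hp)))

end LatticeCon

namespace AlgebraCon

variable {σ : FirstOrder.Language.{u, v}} {A : Type w} [σ.Structure A]

theorem r_of_le {c d : AlgebraCon σ A} (h : c ≤ d) {x y : A} (hxy : c.r x y) : d.r x y := h hxy

/-- The principal congruence generated by a pair of elements. -/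
def principal (σ : FirstOrder.Language.{u, v}) {A : Type w} [σ.Structure A] (x y : A) :
    AlgebraCon σ A := sInf {c | c.r x y}

theorem principal_le {x y : A} {c : AlgebraCon σ A} : principal σ x y ≤ c ↔ c.r x y := by
  refine ⟨fun h => h ?_, fun h => sInf_le h⟩
  rintro _ ⟨d, hd, rfl⟩
  exact hd

theorem r_principal (x y : A) : (principal σ x y).r x y := principal_le.1 le_rfl

theorem exists_mem_r_of_sSup_r {s : Set (AlgebraCon σ A)} (hs : s.Nonempty)
    (hd : DirectedOn (· ≤ ·) s) {x y : A} (h : (sSup s).r x y) : ∃ c ∈ s, c.r x y := by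
  let U : AlgebraCon σ A :=
    { r := fun x y => ∃ c ∈ s, c.r x y
      iseqv :=
        { refl := fun x => hs.imp fun c hc => ⟨hc, c.refl x⟩
          symm := fun ⟨c, hc, h⟩ => ⟨c, hc, c.symm h⟩
          trans := by
            rintro x y z ⟨c, hc, h⟩ ⟨d, hd', h'⟩
            obtain ⟨m, hm, hcm, hdm⟩ := hd c hc d hd'
            exact ⟨m, hm, m.trans (hcm h) (hdm h')⟩ }
      funMap := by
        intro n f x y h
        choose c hc h using h
        -- Operations have finite arity, so a single member of the directed family relates all pairs
        -- of arguments.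
        have : Nonempty s := hs.to_subtype
        obtain ⟨⟨m, hm⟩, hcm⟩ := (directedOn_iff_directed.1 hd).finite_le
          (fun i : Fin n => (⟨c i, hc i⟩ : s))
        exact ⟨m, hm, m.funMap f fun i => r_of_le (hcm i) (h i)⟩ }
  exact r_of_le (sSup_le fun c hc _ _ h => ⟨c, hc, h⟩ : sSup s ≤ U) h

theorem isCompactElement_principal (x y : A) : IsCompactElement (principal σ x y) := by
  rw [CompleteLattice.isCompactElement_iff_le_of_directed_sSup_le]
  intro s hs hd h
  obtain ⟨c, hc, h⟩ := exists_mem_r_of_sSup_r hs hd (principal_le.1 h)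
  exact ⟨c, hc, principal_le.2 h⟩

theorem exists_finset_sup_principal {c : AlgebraCon σ A} (hc : IsCompactElement c) :
    ∃ G : Finset (A × A), G.sup (fun p => principal σ p.1 p.2) = c := by
  obtain ⟨G, hG⟩ := CompleteLattice.IsCompactElement.exists_finset_of_le_iSup _ hc (fun p : {p : A × A // c.r p.1 p.2} =>
      principal σ p.1.1 p.1.2) fun x y h =>
    r_of_le (le_iSup (fun p : {p : A × A // c.r p.1 p.2} => principal σ p.1.1 p.1.2) ⟨(x, y), h⟩)
      (r_principal x y)
  refine ⟨G.map (Function.Embedding.subtype _), le_antisymm (Finset.sup_le fun p hp => ?_) ?_⟩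
  · obtain ⟨q, -, rfl⟩ := Finset.mem_map.1 hp
    exact principal_le.2 q.2
  · exact hG.trans (iSup₂_le fun p hp =>
      Finset.le_sup (f := fun p : A × A => principal σ p.1 p.2) (Finset.mem_map_of_mem _ hp))

/-- If `A` has almost permutable congruences and `Con A ≅ D`, then the principal congruences of `A`
yield a V-distance of type `3/2` with values in the compact elements of `D`. -/
theorem exists_isVDistanceThreeHalves {D : Type u₁} [CompleteLattice D]
    (hA : AlmostPermutableCongruences σ A) (f : D ≃o AlgebraCon σ A) :
    ∃ δ : A → A → CompactElements D,
      IsVDistanceThreeHalves δ ∧ JoinGenerates (Set.range fun p : A × A => δ p.1 p.2) := by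
  classical
  let δ : A → A → CompactElements D := fun x y =>
    ⟨f.symm (principal σ x y), f.symm.isCompactElement (isCompactElement_principal x y)⟩
  have hδ : ∀ {x y : A} {a : CompactElements D}, δ x y ≤ a ↔ (f a).r x y := fun {x y a} =>
    (f.symm_apply_le (x := a.1)).trans principal_le
  have sup_r : ∀ {x y : A} {a b : CompactElements D}, δ x y ≤ a ⊔ b ↔ (f a ⊔ f b).r x y :=
    fun {x y a b} => by
      rw [hδ, ← map_sup]
  refine ⟨δ, ⟨⟨fun x => ?_, fun x y => ?_, fun x y z => ?_⟩, fun x y a b h => ?_⟩, fun s => ?_⟩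
  · exact le_bot_iff.1 (hδ.2 ((f _).refl x))
  · exact le_antisymm (hδ.2 ((f _).symm (hδ.1 le_rfl))) (hδ.2 ((f _).symm (hδ.1 le_rfl)))
  · exact hδ.2 ((f _).trans (hδ.1 le_sup_left) (hδ.1 le_sup_right))
  · rcases (hA _ _ x y).1 (sup_r.1 h) with ⟨z, h⟩ | ⟨z, h⟩
    · exact ⟨z, .inl ⟨hδ.2 h.1, hδ.2 h.2⟩⟩
    · exact ⟨z, .inr ⟨hδ.2 h.1, hδ.2 h.2⟩⟩
  · obtain ⟨G, hG⟩ := exists_finset_sup_principal (f.isCompactElement s.2)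
    refine ⟨G.image fun p => δ p.1 p.2, ?_, ?_⟩
    · intro a ha
      obtain ⟨p, -, rfl⟩ := Finset.mem_image.1 ha
      exact ⟨p, rfl⟩
    · rw [Finset.sup_image]
      refine le_antisymm (Finset.sup_le fun p hp => hδ.2 ?_) ?_
      · rw [← hG]
        exact principal_le.1 (Finset.le_sup (f := fun p : A × A => principal σ p.1 p.2) hp)
      · refine f.le_iff_le.1 (hG.ge.trans (Finset.sup_le fun p hp => principal_le.2 (hδ.1 ?_)))
        exact Finset.le_sup (f := id ∘ fun p : A × A => δ p.1 p.2) hp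

end AlgebraCon

end PrincipalCongruences

/-! ### Free sets -/

section FreeSets

open Cardinal

theorem exists_mem_forall_notMem_of_mk_lt {I K : Type u} {s : Set I} {t : Set K} {κ : Cardinal.{u}}
    (hκ : ℵ₀ ≤ κ) (ht : #t ≤ κ) (hs : κ < #s) (Φ : K → Set I) (hΦ : ∀ k, #(Φ k) ≤ κ) :
    ∃ i ∈ s, ∀ k ∈ t, i ∉ Φ k := by
  by_contra! h
  refine hs.not_ge ((mk_le_mk_of_subset (t := ⋃ k ∈ t, Φ k) fun i hi => ?_).trans
    ((mk_biUnion_le Φ t).trans ?_))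
  · obtain ⟨k, hk, hik⟩ := h i hi
    exact Set.mem_biUnion hk hik
  · exact (mul_le_mul' ht (ciSup_le' fun k : t => hΦ k)).trans (mul_eq_self hκ).le

/-- Kuratowski's Free Set Theorem for triples in a set of cardinality at least `ℵ₂`. -/
theorem exists_free_triple {I : Type u} {s : Set I} (hs : ℵ_ 2 ≤ #s) (Φ : I → I → Finset I) :
    ∃ i ∈ s, ∃ j ∈ s, ∃ k ∈ s, i ≠ j ∧ j ≠ k ∧ i ≠ k ∧
      i ∉ Φ j k ∧ j ∉ Φ i k ∧ k ∉ Φ i j := by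
  classical
  have h01 : (ℵ₀ : Cardinal.{u}) < ℵ_ 1 := aleph0_lt_aleph_one
  have h12 : (ℵ_ 1 : Cardinal.{u}) < ℵ_ 2 := aleph_lt_aleph.2 one_lt_two
  have fin : ∀ {κ : Cardinal.{u}} (t : Finset I), ℵ₀ ≤ κ → #(t : Set I) ≤ κ := fun t h =>
    (lt_aleph0_of_finite _).le.trans h
  -- With |A| = ℵ₁ and |B| = ℵ₀, choose k against all pairs from A, then j in A against all of B,
  -- and finally i in B against one finite set. Inserting an argument into the forbidden set makes
  -- the three indices distinct.
  obtain ⟨A, hAs, hA⟩ := le_mk_iff_exists_subset.1 (h12.le.trans hs)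
  obtain ⟨B, hBA, hB⟩ := le_mk_iff_exists_subset.1 (h01.le.trans hA.ge)
  obtain ⟨k, hk, hkA⟩ := exists_mem_forall_notMem_of_mk_lt (s := s) (t := A ×ˢ A) h01.le
    (by rw [mk_setProd, hA, mul_eq_self h01.le]) (h12.trans_le hs)
    (fun p => (insert p.1 (Φ p.1 p.2) : Finset I)) fun p => fin _ h01.le
  obtain ⟨j, hj, hjB⟩ := exists_mem_forall_notMem_of_mk_lt (s := A) (t := B) le_rfl hB.le
    (h01.trans_le hA.ge) (fun i => (insert i (Φ i k) : Finset I)) fun p => fin _ le_rfl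
  have hBinf : B.Infinite := by
    rw [← Set.infinite_coe_iff, Cardinal.infinite_iff, hB]
  obtain ⟨i, hi, hij⟩ := hBinf.exists_notMem_finset (Φ j k)
  have h1 := hjB i hi
  have h2 := hkA (i, j) ⟨hBA hi, hj⟩
  have h3 := hkA (j, i) ⟨hj, hBA hi⟩
  simp only [Finset.coe_insert, Set.mem_insert_iff, Finset.mem_coe, not_or] at h1 h2 h3
  exact ⟨i, hAs (hBA hi), j, hAs hj, k, hk, Ne.symm h1.1, Ne.symm h3.1, Ne.symm h2.1, hij,
    h1.2, h2.2⟩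

end FreeSets

/-! ### Finite supports and cuts into the two-element lattice -/

section Evaluation

/-- The finite set of generators that occur in a bounded lattice term. -/
def BoundedLatticeTerm.vars {X : Type u} [DecidableEq X] : BoundedLatticeTerm X → Finset X
  | .of x => {x}
  | .bot => ∅
  | .top => ∅
  | .sup s t => s.vars ∪ t.vars
  | .inf s t => s.vars ∪ t.vars

namespace BoundedLatticeTerm

variable {X : Type u} {M : Type v} [Lattice M] [BoundedOrder M]

theorem eval_congr [DecidableEq X] {φ ψ : X → M} (t : BoundedLatticeTerm X)
    (h : ∀ x ∈ t.vars, φ x = ψ x) : t.eval φ = t.eval ψ := by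
  induction t with
  | of x => exact h x (Finset.mem_singleton_self x)
  | bot => rfl
  | top => rfl
  | sup s t hs ht =>
    simp only [vars, Finset.mem_union] at h
    simp only [eval, hs fun x hx => h x (.inl hx), ht fun x hx => h x (.inr hx)]
  | inf s t hs ht =>
    simp only [vars, Finset.mem_union] at h
    simp only [eval, hs fun x hx => h x (.inl hx), ht fun x hx => h x (.inr hx)]

end BoundedLatticeTerm

/-- The map to `{⊥, ⊤}` that sends exactly the elements above `s` to `⊤`. -/
noncomputable def upperIndicator {M : Type v} [Lattice M] [BoundedOrder M] (s x : M) : M :=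
  open Classical in if s ≤ x then ⊤ else ⊥

/-- `{⊥, s, t, ⊤}` is a sublattice in which `s` is join-prime. -/
structure IsJoinPrimeWith {M : Type v} [Lattice M] [BoundedOrder M] (s t : M) : Prop where
  ne_bot : s ≠ ⊥
  sup_mem : s ⊔ t ∈ ({⊥, s, t, ⊤} : Set M)
  inf_mem : s ⊓ t ∈ ({⊥, s, t, ⊤} : Set M)
  le_or_le : ∀ x ∈ ({⊥, s, t, ⊤} : Set M), ∀ y ∈ ({⊥, s, t, ⊤} : Set M),
    s ≤ x ⊔ y → s ≤ x ∨ s ≤ y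

namespace IsJoinPrimeWith

variable {X : Type u} {M : Type v} [Lattice M] [BoundedOrder M] {s t : M}

theorem sup_mem_of_mem (h : IsJoinPrimeWith s t) {x y : M} (hx : x ∈ ({⊥, s, t, ⊤} : Set M))
    (hy : y ∈ ({⊥, s, t, ⊤} : Set M)) : x ⊔ y ∈ ({⊥, s, t, ⊤} : Set M) := by
  have := h.sup_mem
  have h' : t ⊔ s ∈ ({⊥, s, t, ⊤} : Set M) := sup_comm s t ▸ this
  rcases hx with rfl | rfl | rfl | rfl <;> rcases hy with rfl | rfl | rfl | rfl <;>
    first | assumption | simp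

theorem inf_mem_of_mem (h : IsJoinPrimeWith s t) {x y : M} (hx : x ∈ ({⊥, s, t, ⊤} : Set M))
    (hy : y ∈ ({⊥, s, t, ⊤} : Set M)) : x ⊓ y ∈ ({⊥, s, t, ⊤} : Set M) := by
  have := h.inf_mem
  have h' : t ⊓ s ∈ ({⊥, s, t, ⊤} : Set M) := inf_comm s t ▸ this
  rcases hx with rfl | rfl | rfl | rfl <;> rcases hy with rfl | rfl | rfl | rfl <;>
    first | assumption | simp

theorem eval_mem (h : IsJoinPrimeWith s t) {φ : X → M} (hφ : ∀ x, φ x ∈ ({⊥, s, t, ⊤} : Set M))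
    (τ : BoundedLatticeTerm X) : τ.eval φ ∈ ({⊥, s, t, ⊤} : Set M) := by
  induction τ with
  | of x => exact hφ x
  | bot => simp [BoundedLatticeTerm.eval]
  | top => simp [BoundedLatticeTerm.eval]
  | sup τ τ' ih ih' => exact h.sup_mem_of_mem ih ih'
  | inf τ τ' ih ih' => exact h.inf_mem_of_mem ih ih'

/-- The indicator of an up-set above s always preserves meets; it preserves joins only where s is
join-prime. Primeness inside {⊥, s, t, ⊤} suffices because all values of terms stay there. -/
theorem eval_upperIndicator (h : IsJoinPrimeWith s t) {φ : X → M}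
    (hφ : ∀ x, φ x ∈ ({⊥, s, t, ⊤} : Set M)) (τ : BoundedLatticeTerm X) :
    τ.eval (fun x => upperIndicator s (φ x)) = upperIndicator s (τ.eval φ) := by
  induction τ with
  | of x => rfl
  | bot => simp [BoundedLatticeTerm.eval, upperIndicator, h.ne_bot]
  | top => simp [BoundedLatticeTerm.eval, upperIndicator]
  | sup τ τ' ih ih' =>
    have key : s ≤ τ.eval φ ⊔ τ'.eval φ ↔ s ≤ τ.eval φ ∨ s ≤ τ'.eval φ :=
      ⟨h.le_or_le _ (h.eval_mem hφ τ) _ (h.eval_mem hφ τ'),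
        fun h => h.elim le_sup_of_le_left le_sup_of_le_right⟩
    rw [BoundedLatticeTerm.eval, ih, ih', BoundedLatticeTerm.eval]
    by_cases h1 : s ≤ τ.eval φ <;> by_cases h2 : s ≤ τ'.eval φ <;>
      simp [upperIndicator, key, h1, h2]
  | inf τ τ' ih ih' =>
    rw [BoundedLatticeTerm.eval, ih, ih', BoundedLatticeTerm.eval]
    simp only [upperIndicator, le_inf_iff]
    by_cases h1 : s ≤ τ.eval φ <;> by_cases h2 : s ≤ τ'.eval φ <;> simp [h1, h2]

end IsJoinPrimeWith

theorem upperIndicator_eq_iff {M : Type v} [Lattice M] [BoundedOrder M] [Nontrivial M]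
    {s x y : M} : upperIndicator s x = upperIndicator s y ↔ (s ≤ x ↔ s ≤ y) := by
  unfold upperIndicator
  by_cases h1 : s ≤ x <;> by_cases h2 : s ≤ y <;> simp [h1, h2]

end Evaluation

/-! ### Failure of `WURPEq` from a bad triple -/

section MainArgument

/-- Three elements `p`, `q`, `r` of a bounded lattice such that `{⊥, p, q, ⊤}` and `{⊥, q, r, ⊤}`
are four-element Boolean sublattices and `r` is join-prime in the sublattice `{⊥, r, p, ⊤}`,
with `r` not below `p`. -/
structure IsBadTriple {M : Type v} [Lattice M] [BoundedOrder M] (p q r : M) : Prop where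
  pq : IsJoinPrimeWith p q
  qp : IsJoinPrimeWith q p
  qr : IsJoinPrimeWith q r
  rq : IsJoinPrimeWith r q
  rp : IsJoinPrimeWith r p
  not_le_pq : ¬ p ≤ q
  not_le_qp : ¬ q ≤ p
  not_le_qr : ¬ q ≤ r
  not_le_rq : ¬ r ≤ q
  not_le_rp : ¬ r ≤ p

/-- In a four-element Boolean sublattice `{⊥, s, t, ⊤}`, elements are separated by the two
join-irreducible elements. -/
theorem IsJoinPrimeWith.eq_of_le_iff_le {M : Type v} [Lattice M] [BoundedOrder M] {s t x y : M}
    (hst : IsJoinPrimeWith s t) (hts : IsJoinPrimeWith t s) (h : ¬ s ≤ t) (h' : ¬ t ≤ s)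
    (hx : x ∈ ({⊥, s, t, ⊤} : Set M)) (hy : y ∈ ({⊥, s, t, ⊤} : Set M))
    (h1 : s ≤ x ↔ s ≤ y) (h2 : t ≤ x ↔ t ≤ y) : x = y := by
  have hs := hst.ne_bot
  have ht := hts.ne_bot
  rcases hx with rfl | rfl | rfl | rfl <;> rcases hy with rfl | rfl | rfl | rfl <;>
    first | rfl | (exfalso; simp_all)

/-- The kernel of the evaluation at an assignment of the generators, pulled back along a
homomorphism to the free bounded lattice. -/
noncomputable def evalKer {L : Type u₁} [Lattice L] {M : Type v} [Lattice M] [BoundedOrder M] {X : Type u₂}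
    (π : LatticeHom L (FreeBoundedLattice M X)) (φ : X → M) : LatticeCon L :=
  let f := (FreeBoundedLattice.existsUnique_lift (M := M) (K := M) (fun _ _ h => h) φ).choose
  { r := fun x y => f (π x) = f (π y)
    iseqv := ⟨fun _ => rfl, fun h => h.symm, fun h h' => h.trans h'⟩
    inf := fun h h' => by simp only [map_inf, h, h']
    sup := fun h h' => by simp only [map_sup, h, h'] }

variable {L : Type u₁} [Lattice L] {M : Type v} [Lattice M] [BoundedOrder M] {X : Type u₂}

theorem evalKer_r_iff (π : LatticeHom L (FreeBoundedLattice M X)) (φ : X → M) {x y : L}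
    {s t : BoundedLatticeTerm X} (hx : π x = FreeBoundedLattice.mk s)
    (hy : π y = FreeBoundedLattice.mk t) : (evalKer π φ).r x y ↔ s.eval φ = t.eval φ := by
  have hex := FreeBoundedLattice.existsUnique_lift (M := M) (K := M) (fun _ _ h => h) φ
  have key : ∀ t, hex.choose (FreeBoundedLattice.mk t) = t.eval φ := by
    have hf := hex.choose_spec.1
    generalize hex.choose = f at hf
    intro t
    induction t with
    | of x => exact hf x
    | bot => exact map_bot f
    | top => exact map_top f
    | sup s t hs ht => rw [FreeBoundedLattice.mk_sup, map_sup, hs, ht]; rfl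
    | inf s t hs ht => rw [FreeBoundedLattice.mk_inf, map_inf, hs, ht]; rfl
  change hex.choose (π x) = hex.choose (π y) ↔ _
  rw [hx, hy, key, key]

/-- Whether a compact congruence is contained in the kernel of an evaluation is decided by finitely
many equations between terms. -/
theorem exists_finset_le_evalKer_iff (π : LatticeHom L (FreeBoundedLattice M X)) (c : ConC L) :
    ∃ G : Finset (BoundedLatticeTerm X × BoundedLatticeTerm X), ∀ φ : X → M,
      c.1 ≤ evalKer π φ ↔ ∀ p ∈ G, p.1.eval φ = p.2.eval φ := by
  classical
  obtain ⟨G, hG⟩ := LatticeCon.exists_finset_le_iff c.2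
  have hτ : ∀ x, ∃ t, π x = FreeBoundedLattice.mk t := fun x => ⟨_, (Quotient.out_eq (π x)).symm⟩
  choose τ hτ using hτ
  refine ⟨G.image fun p => (τ p.1, τ p.2), fun φ => ?_⟩
  rw [hG, Finset.forall_mem_image]
  exact forall₂_congr fun p _ => evalKer_r_iff π φ (hτ p.1) (hτ p.2)

/-- If the variety generator `M` has a bad triple, then `WURP⁼` fails in the compact congruence
semilattice of every lattice that maps onto the free bounded lattice on `ℵ₂` generators. -/
theorem IsBadTriple.not_wurpEq [Nontrivial M] {p q r : M} (hM : IsBadTriple p q r)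
    (hX : Cardinal.mk X = Cardinal.aleph 2) (π : LatticeHom L (FreeBoundedLattice M X))
    (hπ : Function.Surjective π) : ¬ WURPEq.{u₁, u₃} (ConC L) := by
  classical
  intro hW
  -- The index set must live in the universe of `WURPEq`, which need not be that of X.
  obtain ⟨I, hI⟩ : ∃ I : Type u₃, Cardinal.mk I = Cardinal.aleph 2 := ⟨_, Cardinal.mk_out _⟩
  obtain ⟨g⟩ : Nonempty (X ≃ I × Bool) := by
    rw [← Cardinal.lift_mk_eq', Cardinal.mk_prod, hX, hI]
    simpa using (Cardinal.mul_eq_left (Cardinal.aleph0_le_aleph 2)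
      (Cardinal.ofNat_lt_aleph0.le.trans (Cardinal.aleph0_le_aleph 2)) two_ne_zero).symm
  choose ρ hρ using fun t : BoundedLatticeTerm X => hπ (FreeBoundedLattice.mk t)
  let gen : I → Bool → L := fun i ε => ρ (.of (g.symm (i, ε)))
  let Θ : L → L → ConC L := fun x y =>
    ⟨LatticeCon.principal x y, LatticeCon.isCompactElement_principal x y⟩
  let e : ConC L := Θ (ρ .bot) (ρ .top)
  let a : I → ConC L := fun i => Θ (ρ .bot) (gen i false) ⊔ Θ (gen i true) (ρ .top)
  let b : I → ConC L := fun i => Θ (gen i false) (gen i true)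
  have Θ_le : ∀ (s t : BoundedLatticeTerm X) (φ : X → M),
      (Θ (ρ s) (ρ t)).1 ≤ evalKer π φ ↔ s.eval φ = t.eval φ := fun s t φ =>
    LatticeCon.principal_le.trans (evalKer_r_iff π φ (hρ s) (hρ t))
  have e_le : ∀ φ : X → M, ¬ e.1 ≤ evalKer π φ := fun φ h => bot_ne_top ((Θ_le _ _ φ).1 h)
  have a_le : ∀ (φ : X → M) (i : I), φ (g.symm (i, false)) = ⊥ → φ (g.symm (i, true)) = ⊤ →
      (a i).1 ≤ evalKer π φ := fun φ i h h' =>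
    sup_le ((Θ_le .bot (.of _) φ).2 h.symm) ((Θ_le (.of _) .top φ).2 h')
  have b_le : ∀ (φ : X → M) (i : I), φ (g.symm (i, false)) = φ (g.symm (i, true)) →
      (b i).1 ≤ evalKer π φ := fun φ i h => (Θ_le (.of _) (.of _) φ).2 h
  have hab : ∀ i, e ≤ a i ⊔ b i := by
    intro i
    refine LatticeCon.principal_le.2 ?_
    refine Setoid.trans' _ (y := gen i false) ?_ (Setoid.trans' _ (y := gen i true) ?_ ?_)
    · exact LatticeCon.principal_le.1 (le_sup_left.trans (le_sup_left : (a i).1 ≤ _))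
    · exact LatticeCon.principal_le.1 (le_sup_right : (b i).1 ≤ _)
    · exact LatticeCon.principal_le.1 (le_sup_right.trans (le_sup_left : (a i).1 ≤ _))
  obtain ⟨m, -, hm⟩ := hW e
  obtain ⟨J, c, hJ, hc1, hc2, hc3⟩ := hm I a b hab
  obtain ⟨u, hu⟩ : ∃ u, Cardinal.aleph 2 ≤ Cardinal.mk (J u) := by
    have hJ' : ∀ i, ∃ u, i ∈ J u := fun i => Set.mem_iUnion.1 (hJ ▸ Set.mem_univ i)
    choose κ hκ using hJ'
    have h2 : (Cardinal.aleph 2 : Cardinal.{u₃}).IsRegular := by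
      have := Cardinal.isRegular_aleph_add_one 1
      rwa [one_add_one_eq_two] at this
    obtain ⟨u, hu⟩ := Cardinal.infinite_pigeonhole_card (fun i => ULift.up.{u₃} (κ i))
      (Cardinal.aleph 2) hI.ge (Cardinal.aleph0_le_aleph 2)
      (by rw [h2.cof_ord]; exact (Cardinal.lt_aleph0_of_finite _).trans_le (Cardinal.aleph0_le_aleph 2))
    refine ⟨u.down, hu.trans (Cardinal.mk_le_mk_of_subset fun i hi => ?_)⟩
    have : κ i = u.down := congrArg ULift.down hi
    exact this ▸ hκ i
  choose G hG using fun i j => exists_finset_le_evalKer_iff π (c i j)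
  -- The indices owning a generator that occurs in the equations deciding c_ij.
  let V : I → I → Finset I := fun i j =>
    (G i j).biUnion fun s => (s.1.vars ∪ s.2.vars).image fun x => (g x).1
  have c_congr : ∀ (i j : I) (φ ψ : X → M), (∀ x, (g x).1 ∈ V i j → φ x = ψ x) →
      ((c i j).1 ≤ evalKer π φ ↔ (c i j).1 ≤ evalKer π ψ) := by
    intro i j φ ψ h
    have h' : ∀ s ∈ G i j, ∀ x ∈ s.1.vars ∪ s.2.vars, φ x = ψ x := fun s hs x hx =>
      h x (Finset.mem_biUnion.2 ⟨s, hs, Finset.mem_image_of_mem _ hx⟩)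
    rw [hG, hG]
    refine forall₂_congr fun s hs => ?_
    rw [s.1.eval_congr fun x hx => h' s hs x (Finset.mem_union_left _ hx),
      s.2.eval_congr fun x hx => h' s hs x (Finset.mem_union_right _ hx)]
  have c_upper : ∀ (i j : I) {s t : M} (φ : X → M), IsJoinPrimeWith s t →
      (∀ x, φ x ∈ ({⊥, s, t, ⊤} : Set M)) →
      ((c i j).1 ≤ evalKer π (fun x => upperIndicator s (φ x)) ↔
        ∀ τ ∈ G i j, (s ≤ τ.1.eval φ ↔ s ≤ τ.2.eval φ)) := by
    intro i j s t φ h hφ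
    rw [hG]
    refine forall₂_congr fun τ _ => ?_
    rw [h.eval_upperIndicator hφ, h.eval_upperIndicator hφ, upperIndicator_eq_iff]
  obtain ⟨i, hi, j, hj, k, hk, hij, hjk, hik, hiV, hjV, hkV⟩ := exists_free_triple hu V
  have c_le : ∀ (i j : I), i ∈ J u → j ∈ J u → ∀ {s t : M} (φ : X → M), IsJoinPrimeWith s t →
      IsJoinPrimeWith t s → ¬ s ≤ t → ¬ t ≤ s → (∀ x, φ x ∈ ({⊥, s, t, ⊤} : Set M)) →
      (((c i j).1 ≤ evalKer π (fun x => upperIndicator s (φ x))) ∧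
        ((c i j).1 ≤ evalKer π (fun x => upperIndicator t (φ x)))) → (c i j).1 ≤ evalKer π φ := by
    intro i j hi hj s t φ hst hts h h' hφ ⟨h1, h2⟩
    have hφ' : ∀ x, φ x ∈ ({⊥, t, s, ⊤} : Set M) := fun x => by
      rw [Set.insert_comm t s]
      exact hφ x
    rw [c_upper i j φ hst hφ] at h1
    rw [c_upper i j φ hts hφ'] at h2
    rw [hG]
    exact fun τ hτ => hst.eq_of_le_iff_le hts h h' (hst.eval_mem hφ _) (hst.eval_mem hφ _)
      (h1 τ hτ) (h2 τ hτ)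
  have c_le_of_a : ∀ φ : X → M, ∀ i ∈ J u, ∀ j ∈ J u, (a i).1 ≤ evalKer π φ →
      (a j).1 ≤ evalKer π φ → (c i j).1 ≤ evalKer π φ := fun φ i hi j hj h h' =>
    le_trans (hc1 u i hi j hj).1 (sup_le h h')
  have c_le_of_b : ∀ φ : X → M, ∀ i ∈ J u, ∀ j ∈ J u, (b i).1 ≤ evalKer π φ →
      (b j).1 ≤ evalKer π φ → (c i j).1 ≤ evalKer π φ := fun φ i hi j hj h h' =>
    le_trans (hc1 u i hi j hj).2 (sup_le h h')
  -- The default ⊥ keeps all other generators inside every sublattice used below.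
  let asg : M → M → M → M → M → M → X → M := fun i0 i1 j0 j1 k0 k1 x =>
    if (g x).1 = i then (if (g x).2 then i1 else i0)
    else if (g x).1 = j then (if (g x).2 then j1 else j0)
    else if (g x).1 = k then (if (g x).2 then k1 else k0) else ⊥
  have asg_i : ∀ i0 i1 j0 j1 k0 k1 ε,
      asg i0 i1 j0 j1 k0 k1 (g.symm (i, ε)) = if ε then i1 else i0 := by
    intros
    simp [asg]
  have asg_j : ∀ i0 i1 j0 j1 k0 k1 ε,
      asg i0 i1 j0 j1 k0 k1 (g.symm (j, ε)) = if ε then j1 else j0 := by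
    intros
    simp [asg, hij.symm]
  have asg_k : ∀ i0 i1 j0 j1 k0 k1 ε,
      asg i0 i1 j0 j1 k0 k1 (g.symm (k, ε)) = if ε then k1 else k0 := by
    intros
    simp [asg, hik.symm, hjk.symm]
  let φ : X → M := asg ⊥ p q ⊤ ⊥ r
  have up_bot : ∀ {s t : M}, IsJoinPrimeWith s t → upperIndicator s ⊥ = (⊥ : M) := fun h => by
    simp [upperIndicator, h.ne_bot]
  have up_top : ∀ s : M, upperIndicator s ⊤ = (⊤ : M) := fun s => by simp [upperIndicator]
  have up_self : ∀ s : M, upperIndicator s s = (⊤ : M) := fun s => by simp [upperIndicator]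
  have up_not : ∀ {s t : M}, ¬ s ≤ t → upperIndicator s t = (⊥ : M) := fun h => by
    simp [upperIndicator, h]
  have h1 : (c i j).1 ≤ evalKer π φ := by
    rw [c_congr i j φ (asg ⊥ p q ⊤ ⊥ ⊥) fun x hx => by
      have : (g x).1 ≠ k := fun h => hkV (h ▸ hx)
      simp [φ, asg, this]]
    -- The cut at p sends the pairs of i and j to (⊥, ⊤) and (⊥, ⊤), collapsing both a's; the cut at
    -- q sends them to (⊥, ⊥) and (⊤, ⊤), collapsing both b's.
    refine c_le i j hi hj _ hM.pq hM.qp hM.not_le_pq hM.not_le_qp (fun x => ?_) ⟨?_, ?_⟩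
    · simp only [asg]
      split_ifs <;> simp
    · refine c_le_of_a _ i hi j hj (a_le _ _ ?_ ?_) (a_le _ _ ?_ ?_) <;>
        simp [asg_i, asg_j, up_bot hM.pq, up_top, up_self, up_not hM.not_le_pq]
    · refine c_le_of_b _ i hi j hj (b_le _ _ ?_) (b_le _ _ ?_) <;>
        simp [asg_i, asg_j, up_bot hM.qp, up_top, up_self, up_not hM.not_le_qp]
  have h2 : (c j k).1 ≤ evalKer π φ := by
    rw [c_congr j k φ (asg ⊥ ⊥ q ⊤ ⊥ r) fun x hx => by
      have : (g x).1 ≠ i := fun h => hiV (h ▸ hx)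
      simp [φ, asg, this]]
    -- Here the cut at q collapses both b's and the cut at r both a's.
    refine c_le j k hj hk _ hM.qr hM.rq hM.not_le_qr hM.not_le_rq (fun x => ?_) ⟨?_, ?_⟩
    · simp only [asg]
      split_ifs <;> simp
    · refine c_le_of_b _ j hj k hk (b_le _ _ ?_) (b_le _ _ ?_) <;>
        simp [asg_k, asg_j, up_bot hM.qr, up_top, up_self, up_not hM.not_le_qr]
    · refine c_le_of_a _ j hj k hk (a_le _ _ ?_ ?_) (a_le _ _ ?_ ?_) <;>
        simp [asg_k, asg_j, up_bot hM.rq, up_top, up_self, up_not hM.not_le_rq]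
  have h3 : (c i k).1 ≤ evalKer π φ := le_trans (hc3 i j k) (sup_le h1 h2)
  rw [c_congr i k φ (asg ⊥ p ⊥ ⊥ ⊥ r) fun x hx => by
    have : (g x).1 ≠ j := fun h => hjV (h ▸ hx)
    simp [φ, asg, this]] at h3
  have h4 : (c i k).1 ≤ evalKer π fun x => upperIndicator r (asg ⊥ p ⊥ ⊥ ⊥ r x) := by
    rw [c_upper i k _ hM.rp fun x => by
      simp only [asg]
      split_ifs <;> simp]
    rw [hG] at h3
    exact fun τ hτ => by rw [h3 τ hτ]
  -- As r is not below p, the cut at r sends the pairs of i and k to (⊥, ⊥) and (⊥, ⊤), collapsing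
  -- b_i and a_k.
  refine e_le _ (le_trans (hc2 u i hi k hk) (sup_le (sup_le (a_le _ _ ?_ ?_) (b_le _ _ ?_)) h4)) <;>
    simp [asg_i, asg_k, up_bot hM.rp, up_self, up_not hM.not_le_rp]

end MainArgument

/-! ### Bad triples in `M3Lattice` and `N5Lattice` -/

section Generators

instance M3Lattice.instBoundedOrder : BoundedOrder M3Lattice where
  bot := .zero
  top := .one
  bot_le x := sup_eq_right.mp (by cases x <;> rfl)
  le_top x := sup_eq_right.mp (by cases x <;> rfl)

instance M3Lattice.instNontrivial : Nontrivial M3Lattice := ⟨⟨.zero, .one, nofun⟩⟩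

instance N5Lattice.instBoundedOrder : BoundedOrder N5Lattice where
  bot := .zero
  top := .one
  bot_le x := sup_eq_right.mp (by cases x <;> rfl)
  le_top x := sup_eq_right.mp (by cases x <;> rfl)

instance N5Lattice.instNontrivial : Nontrivial N5Lattice := ⟨⟨.zero, .one, nofun⟩⟩

instance M3Lattice.instDecidableLE : DecidableLE M3Lattice := fun x y =>
  decidable_of_iff (x ⊔ y = y) sup_eq_right

instance N5Lattice.instDecidableLE : DecidableLE N5Lattice := fun x y =>
  decidable_of_iff (x ⊔ y = y) sup_eq_right

theorem M3Lattice.isBadTriple : IsBadTriple M3Lattice.p M3Lattice.q M3Lattice.r := by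
  constructor <;> first | decide | (constructor <;> decide)

/-- Here p < r, so {⊥, p, r, ⊤} is a chain rather than Boolean. This case is why `IsBadTriple` asks
of that sublattice only that r be join-prime and not below p. -/
theorem N5Lattice.isBadTriple : IsBadTriple N5Lattice.a N5Lattice.b N5Lattice.c := by
  constructor <;> first | decide | (constructor <;> decide)

end Generators

theorem corollaryC {L : Type u₁} [Lattice L] {X : Type u₂}
    (hX : Cardinal.mk X = Cardinal.aleph 2)
    (hL : (∃ f : LatticeHom L (FreeBoundedLattice M3Lattice X), Function.Surjective f) ∨
      (∃ f : LatticeHom L (FreeBoundedLattice N5Lattice X), Function.Surjective f)) :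
    ¬ WURPEq.{u₁, u₃} (ConC L) ∧
    (¬ ∃ (Y : Type u₄) (δ : Y → Y → ConC L),
      IsVDistanceThreeHalves δ ∧ JoinGenerates (Set.range fun p : Y × Y => δ p.1 p.2)) ∧
    (¬ ∃ (σ : FirstOrder.Language.{u₅, u₆}) (_ : σ.IsAlgebraic) (A : Type u₇)
      (_ : σ.Structure A),
      AlmostPermutableCongruences σ A ∧ Nonempty (LatticeCon L ≃o AlgebraCon σ A)) := by
  have hW : ¬ WURPEq.{u₁, u₃} (ConC L) := by
    rcases hL with ⟨π, hπ⟩ | ⟨π, hπ⟩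
    · exact M3Lattice.isBadTriple.not_wurpEq hX π hπ
    · exact N5Lattice.isBadTriple.not_wurpEq hX π hπ
  refine ⟨hW, ?_, ?_⟩
  · rintro ⟨Y, δ, hδ, hgen⟩
    exact hW (hδ.wurpEq hgen)
  · rintro ⟨σ, -, A, _, hA, ⟨f⟩⟩
    obtain ⟨δ, hδ, hgen⟩ := AlgebraCon.exists_isVDistanceThreeHalves hA f
    exact hW (hδ.wurpEq hgen)
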